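/- Let $k \ge 2$ be an integer and let $PSL(2,2^k)$ be the projective special linear group of degree $2$ over the field with $2^k$ elements. For a finite non-abelian group $G$ with centre $Z(G)$, the commuting graph $\Gamma_G$ is the simple graph with vertex set $G \setminus Z(G)$ in which two distinct vertices $x, y$ are adjacent if and only if $xy = yx$. For a finite graph $\mathcal{G}$ with degree matrix $D$ and adjacency matrix $A$, let $\operatorname{L-spec}(\mathcal{G})$ and $\operatorname{Q-spec}(\mathcal{G})$ be the multisets of eigenvalues (with multiplicity) of the Laplacian matrix $D - A$ and of the signless Laplacian matrix $D + A$; an exponent in the lists below denotes a multiplicity (and multiplicities of coinciding entries are added). Write $\Gamma = \Gamma_{PSL(2,2^k)}$. Then \[ \operatorname{L-spec}(\Gamma) = \{0^{2^{2k} + 2^k + 1},\ (2^k - 1)^{2^{2k} - 2^k - 2},\ (2^k - 2)^{2^{k - 1}(2^{2k} - 2^{k + 1} - 3)},\ (2^k)^{2^{k - 1}(2^{2k} - 2^{k + 1} + 1)}\} \] and \begin{align*} \operatorname{Q-spec}(\Gamma) = \{&(2^{k + 1} - 4)^{2^k + 1},\ (2^k - 3)^{2^{2k} - 2^k - 2},\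 (2^{k + 1} - 6)^{2^{k - 1}(2^k + 1)},\ (2^k - 4)^{2^{k - 1}(2^{2k} - 2^{k + 1} - 3)},\\ &(2^{k + 1} - 2)^{2^{k - 1}(2^k - 1)},\ (2^k - 2)^{2^{k - 1}(2^{2k} - 2^{k + 1} + 1)}\}. \end{align*} In particular all Laplacian and all signless Laplacian eigenvalues of $\Gamma$ are integers. Moreover, $\Gamma$ is isomorphic to the disjoint union \[ (2^k + 1)K_{2^k - 1} \sqcup 2^{k - 1}(2^k + 1)K_{2^k - 2} \sqcup 2^{k - 1}(2^k - 1)K_{2^k}, \] where $lK_m$ denotes the disjoint union of $l$ copies of the complete graph $K_m$ on $m$ vertices. -/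

import Mathlib

open scoped MatrixGroups

/-- The commuting graph of a group `G`: the vertices are the non-central elements of `G`, and two
distinct vertices are adjacent if and only if they commute. -/
def commutingGraph (G : Type*) [Group G] : SimpleGraph {g : G // g ∉ Subgroup.center G} where
  Adj x y := x ≠ y ∧ (x : G) * (y : G) = (y : G) * (x : G)
  symm := ⟨fun _ _ h => ⟨h.1.symm, h.2.symm⟩⟩
  loopless := ⟨fun _ h => h.1 rfl⟩

/-- The disjoint union of `l` copies of the complete graph on `m` vertices. -/
def copiesOfComplete (l m : ℕ) : SimpleGraph (Fin l × Fin m) where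
  Adj x y := x.1 = y.1 ∧ x.2 ≠ y.2
  symm := ⟨fun _ _ h => ⟨h.1.symm, h.2.symm⟩⟩
  loopless := ⟨fun _ h => h.2 rfl⟩

open Classical in
/-- The Laplacian spectrum of a finite graph: the multiset of eigenvalues of the Laplacian matrix
`D - A`, with multiplicities. -/
noncomputable def laplacianSpectrum {V : Type*} [Finite V] (G : SimpleGraph V) : Multiset ℝ :=
  letI : Fintype V := Fintype.ofFinite V
  (G.lapMatrix ℝ).charpoly.roots

open Classical in
/-- The signless Laplacian spectrum of a finite graph: the multiset of eigenvalues of the signless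
Laplacian matrix `D + A`, with multiplicities. -/
noncomputable def signlessLaplacianSpectrum {V : Type*} [Finite V] (G : SimpleGraph V) :
    Multiset ℝ :=
  letI : Fintype V := Fintype.ofFinite V
  (G.degMatrix ℝ + G.adjMatrix ℝ).charpoly.roots

/-- A finite graph is L-integral if every eigenvalue of its Laplacian matrix is an integer. -/
def IsLIntegral {V : Type*} [Finite V] (G : SimpleGraph V) : Prop :=
  ∀ x ∈ laplacianSpectrum G, ∃ n : ℤ, x = n

/-- A finite graph is Q-integral if every eigenvalue of its signless Laplacian matrix is an
integer. -/
def IsQIntegral {V : Type*} [Finite V] (G : SimpleGraph V) : Prop :=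
  ∀ x ∈ signlessLaplacianSpectrum G, ∃ n : ℤ, x = n

/-!
Let `q = 2 ^ k`. In characteristic two the only scalar matrix of determinant one is the identity, so
`PSL(2, q)` is `SL(2, q)` and the vertices of the commuting graph are the nonidentity matrices `M`
of determinant one.

Two `2 × 2` matrices commute if and only if their vectors `(M₀₁, M₁₀, M₀₀ - M₁₁)` are parallel, and
this vector is nonzero for a nonscalar matrix. Hence `M` and `N` are adjacent exactly when they are
distinct and have the same point `[M₀₁ : M₁₀ : M₀₀ - M₁₁]` in the projective plane over `F`
(`commutingGraph_adj_iff_matrixPoint`), and the graph is a disjoint union of complete graphs, one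
for each point. The sizes of the fibres are as follows.

* Over each of the `q + 1` points of the line `M₀₀ = M₁₁` there are `q - 1` matrices
  (`card_matrixPoint_eq_inl`).
* Over the affine point `(b, c)` the matrices are `e * (z + (1, b; c, 0))` with
  `e ^ 2 * (z ^ 2 + z - b * c) = 1`. Squaring is bijective, so they correspond to the `z` for which
  `z ^ 2 + z ≠ b * c` (`card_matrixPoint_eq_inr`). There are `q - 2` of them if `b * c` is a value of
  the additive map `z ↦ z ^ 2 + z`, whose kernel is `{0, 1}`, and `q` of them otherwise.

The image of this additive map has `q / 2` elements, which gives `q * (q + 1) / 2` points of the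
first affine kind (`two_mul_card_splitPoint`) and `q * (q - 1) / 2` of the second.

For the spectra, both matrices have the form `D + c A` with `c = -1` or `c = 1`. On `K_m` this is
`(m - 1 - c) + c J` with `J` the all-ones matrix of rank one, so its eigenvalues are
`(m - 1) * (1 + c)` once and `m - 1 - c` with multiplicity `m - 1`; the spectrum of a disjoint union
is the sum of the spectra.
-/

/-! ### Spectra of disjoint unions of complete graphs -/

open Polynomial in
theorem Matrix.charpoly_blockDiagonal {n o R : Type*} [Fintype n] [DecidableEq n] [Fintype o]
    [DecidableEq o] [CommRing R] (M : o → Matrix n n R) :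
    (Matrix.blockDiagonal M).charpoly = ∏ i, (M i).charpoly := by
  have : (Matrix.blockDiagonal M).charmatrix =
      Matrix.blockDiagonal fun i => (M i).charmatrix := by
    ext ⟨i, a⟩ ⟨j, b⟩
    by_cases hab : a = b <;> by_cases hij : i = j <;>
      simp [Matrix.blockDiagonal_apply, hab, hij]
  simp only [Matrix.charpoly, this, Matrix.det_blockDiagonal]

open Polynomial in
/-- The matrix `a + b J`, with `J` the all-ones matrix, is a scalar matrix plus a matrix of rank
one. -/
theorem Matrix.roots_charpoly_scalar_add_const {n : ℕ} (a b : ℝ) :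
    (Matrix.scalar (Fin (n + 1)) a + Matrix.of fun _ _ => b).charpoly.roots =
      Multiset.replicate 1 (a + (n + 1) * b) + Multiset.replicate n a := by
  have h1 : (Matrix.of fun _ _ => b : Matrix (Fin (n + 1)) (Fin (n + 1)) ℝ) =
      Matrix.vecMulVec (fun _ => b) (fun _ => 1) := by
    ext; simp [Matrix.vecMulVec_apply]
  have h2 : (Matrix.scalar (Fin (n + 1)) a + Matrix.of fun _ _ => b) =
      Matrix.vecMulVec (fun _ => b) (fun _ => 1) - Matrix.scalar (Fin (n + 1)) (-a) := by
    rw [h1, map_neg, sub_neg_eq_add]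
    exact add_comm _ _
  have h3 : (Matrix.scalar (Fin (n + 1)) a + Matrix.of fun _ _ => b).charpoly =
      (X - C (a + (n + 1) * b)) ^ 1 * (X - C a) ^ n := by
    rw [h2, Matrix.charpoly_sub_scalar, Matrix.charpoly_vecMulVec]
    simp [dotProduct, smul_eq_C_mul]
    ring
  rw [h3, roots_mul, roots_pow, roots_pow, roots_X_sub_C, roots_X_sub_C,
    Multiset.nsmul_singleton, Multiset.nsmul_singleton]
  exact mul_ne_zero (pow_ne_zero _ (X_sub_C_ne_zero _)) (pow_ne_zero _ (X_sub_C_ne_zero _))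

namespace SimpleGraph

open Classical in
/-- The multiset of eigenvalues of `D + c A`, where `D` and `A` are the degree and adjacency
matrices of a finite graph. The Laplacian and signless Laplacian spectra are `c = -1` and
`c = 1`. -/
noncomputable def degAddAdjSpectrum {V : Type*} [Finite V] (c : ℝ) (G : SimpleGraph V) :
    Multiset ℝ :=
  letI : Fintype V := Fintype.ofFinite V
  (G.degMatrix ℝ + c • G.adjMatrix ℝ).charpoly.roots

variable {V W : Type*}

theorem laplacianSpectrum_eq [Finite V] (G : SimpleGraph V) :
    laplacianSpectrum G = degAddAdjSpectrum (-1) G := by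
  simp only [laplacianSpectrum, degAddAdjSpectrum, lapMatrix, neg_one_smul, sub_eq_add_neg]

theorem signlessLaplacianSpectrum_eq [Finite V] (G : SimpleGraph V) :
    signlessLaplacianSpectrum G = degAddAdjSpectrum 1 G := by
  simp only [signlessLaplacianSpectrum, degAddAdjSpectrum, one_smul]

/-- The choice of instances does not matter. -/
theorem degAddAdjSpectrum_eq [Fintype V] [DecidableEq V] (c : ℝ) (G : SimpleGraph V)
    [DecidableRel G.Adj] :
    degAddAdjSpectrum c G = (G.degMatrix ℝ + c • G.adjMatrix ℝ).charpoly.roots := by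
  unfold degAddAdjSpectrum
  convert rfl

theorem Iso.degAddAdjSpectrum_eq [Finite V] [Finite W] {G : SimpleGraph V} {H : SimpleGraph W}
    (e : G ≃g H) (c : ℝ) : degAddAdjSpectrum c G = degAddAdjSpectrum c H := by
  classical
  have := Fintype.ofFinite V
  have := Fintype.ofFinite W
  rw [SimpleGraph.degAddAdjSpectrum_eq, SimpleGraph.degAddAdjSpectrum_eq,
    ← Matrix.charpoly_reindex e.toEquiv (G.degMatrix ℝ + c • G.adjMatrix ℝ)]
  congr 2
  ext v w
  obtain ⟨v, rfl⟩ := e.surjective v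
  obtain ⟨w, rfl⟩ := e.surjective w
  have hv : e.toEquiv.symm (e v) = v := e.toEquiv.symm_apply_apply v
  have hw : e.toEquiv.symm (e w) = w := e.toEquiv.symm_apply_apply w
  simp [degMatrix, Matrix.diagonal_apply, hv, hw, e.map_adj_iff, e.degree_eq]

theorem degree_sum_inl (G : SimpleGraph V) (H : SimpleGraph W) (v : V)
    [Fintype ((G ⊕g H).neighborSet (.inl v))] [Fintype (G.neighborSet v)] :
    (G ⊕g H).degree (.inl v) = G.degree v := by
  rw [← card_neighborSet_eq_degree, ← card_neighborSet_eq_degree, ← Nat.card_eq_fintype_card,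
    ← Nat.card_eq_fintype_card, neighborSet_sum_inl, Nat.card_image_of_injective Sum.inl_injective]

theorem degree_sum_inr (G : SimpleGraph V) (H : SimpleGraph W) (w : W)
    [Fintype ((G ⊕g H).neighborSet (.inr w))] [Fintype (H.neighborSet w)] :
    (G ⊕g H).degree (.inr w) = H.degree w := by
  rw [← card_neighborSet_eq_degree, ← card_neighborSet_eq_degree, ← Nat.card_eq_fintype_card,
    ← Nat.card_eq_fintype_card, neighborSet_sum_inr, Nat.card_image_of_injective Sum.inr_injective]

theorem degAddAdjSpectrum_sum [Finite V] [Finite W] (G : SimpleGraph V) (H : SimpleGraph W)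
    (c : ℝ) : degAddAdjSpectrum c (G ⊕g H) = degAddAdjSpectrum c G + degAddAdjSpectrum c H := by
  classical
  have := Fintype.ofFinite V
  have := Fintype.ofFinite W
  have h : (G ⊕g H).degMatrix ℝ + c • (G ⊕g H).adjMatrix ℝ =
      Matrix.fromBlocks (G.degMatrix ℝ + c • G.adjMatrix ℝ) 0 0
        (H.degMatrix ℝ + c • H.adjMatrix ℝ) := by
    ext (v | v) (w | w) <;>
      simp [degMatrix, Matrix.diagonal_apply, degree_sum_inl, degree_sum_inr,
        adj_comm _ (Sum.inr _) (Sum.inl _)]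
  rw [degAddAdjSpectrum_eq, degAddAdjSpectrum_eq, degAddAdjSpectrum_eq, h,
    Matrix.charpoly_fromBlocks_zero₁₂, Polynomial.roots_mul]
  exact mul_ne_zero (Matrix.charpoly_monic _).ne_zero (Matrix.charpoly_monic _).ne_zero

/-- On `l` copies of `K_{m+1}` the matrix `D + c A` is block diagonal, every block being
`(m - c) + c J` with `J` the all-ones matrix. -/
theorem degAddAdjSpectrum_copiesOfComplete (l m : ℕ) (c : ℝ) :
    degAddAdjSpectrum c (copiesOfComplete l (m + 1)) =
      Multiset.replicate l (m * (1 + c)) + Multiset.replicate (l * m) (m - c) := by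
  classical
  have h : Matrix.reindex (Equiv.prodComm _ _) (Equiv.prodComm _ _)
      ((copiesOfComplete l (m + 1)).degMatrix ℝ + c • (copiesOfComplete l (m + 1)).adjMatrix ℝ) =
      Matrix.blockDiagonal fun _ : Fin l =>
        Matrix.scalar (Fin (m + 1)) (m - c) + Matrix.of fun _ _ => c := by
    have hadj : ∀ v w, (copiesOfComplete l (m + 1)).Adj v w ↔ v.1 = w.1 ∧ v.2 ≠ w.2 :=
      fun _ _ => Iff.rfl
    have hdeg : ∀ v, ((copiesOfComplete l (m + 1)).degree v : ℝ) = m := by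
      rintro ⟨i, j⟩
      simp only [degree_eq_sum_if_adj, Fintype.sum_prod_type, hadj, ite_and]
      rw [Finset.sum_eq_single i (by intro _ _ h; simp [h.symm]) (by simp)]
      simp [Finset.sum_ite, Finset.filter_ne]
    ext ⟨i, a⟩ ⟨j, b⟩
    by_cases hab : a = b <;> by_cases hij : i = j <;>
      simp [degMatrix, Matrix.blockDiagonal_apply, hab, hij, hdeg, hadj]
  rw [degAddAdjSpectrum_eq, ← Matrix.charpoly_reindex (Equiv.prodComm _ _), h,
    Matrix.charpoly_blockDiagonal, Finset.prod_const, Polynomial.roots_pow,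
    Matrix.roots_charpoly_scalar_add_const, smul_add, Multiset.nsmul_replicate,
    Multiset.nsmul_replicate, Finset.card_univ, Fintype.card_fin, mul_one]
  congr 2
  ring

/-- A graph in which adjacency means lying in the same fibre of a map to `(A ⊕ B) ⊕ C` is a disjoint
union of complete graphs, one for each fibre. -/
theorem nonempty_iso_copiesOfComplete [Finite V] (G : SimpleGraph V) {A B C : Type*} [Finite A]
    [Finite B] [Finite C] (f : V → (A ⊕ B) ⊕ C) (hG : ∀ v w, G.Adj v w ↔ v ≠ w ∧ f v = f w)
    {a b c : ℕ} (hA : ∀ i, Nat.card {v // f v = .inl (.inl i)} = a)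
    (hB : ∀ i, Nat.card {v // f v = .inl (.inr i)} = b)
    (hC : ∀ i, Nat.card {v // f v = .inr i} = c) :
    Nonempty (G ≃g (copiesOfComplete (Nat.card A) a ⊕g copiesOfComplete (Nat.card B) b
      ⊕g copiesOfComplete (Nat.card C) c)) := by
  let eA := fun i => Finite.equivFinOfCardEq (hA i)
  let eB := fun i => Finite.equivFinOfCardEq (hB i)
  let eC := fun i => Finite.equivFinOfCardEq (hC i)
  let e : (Σ i, {v // f v = i}) ≃
      (Fin (Nat.card A) × Fin a ⊕ Fin (Nat.card B) × Fin b) ⊕ Fin (Nat.card C) × Fin c :=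
    (Equiv.sumSigmaDistrib _).trans <| Equiv.sumCongr
      ((Equiv.sumSigmaDistrib _).trans <| Equiv.sumCongr
        ((Equiv.sigmaCongrRight eA).trans <| (Equiv.sigmaEquivProd _ _).trans <|
          (Finite.equivFin A).prodCongr (Equiv.refl _))
        ((Equiv.sigmaCongrRight eB).trans <| (Equiv.sigmaEquivProd _ _).trans <|
          (Finite.equivFin B).prodCongr (Equiv.refl _)))
      ((Equiv.sigmaCongrRight eC).trans <| (Equiv.sigmaEquivProd _ _).trans <|
          (Finite.equivFin C).prodCongr (Equiv.refl _))
  have he : ∀ x y, (copiesOfComplete (Nat.card A) a ⊕g copiesOfComplete (Nat.card B) b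
      ⊕g copiesOfComplete (Nat.card C) c).Adj (e x) (e y) ↔ x ≠ y ∧ x.1 = y.1 := by
    rintro ⟨(i | i) | i, x⟩ ⟨(j | j) | j, y⟩ <;>
      simp only [e, Equiv.trans_apply, Equiv.sumSigmaDistrib_apply, Equiv.sumCongr_apply,
        Sum.map_inl, Sum.map_inr, sum_adj_inl, sum_adj_inr] <;>
      first
        | (by_cases hij : i = j
           · subst hij; simp [copiesOfComplete]
           · simp [copiesOfComplete, hij])
        | simp [copiesOfComplete]
  refine ⟨⟨(Equiv.sigmaFiberEquiv f).symm.trans e, fun {v w} => ?_⟩⟩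
  rw [hG]
  refine (he _ _).trans ?_
  rw [(Equiv.injective _).ne_iff]
  exact Iff.rfl

end SimpleGraph

/-! ### Points of the projective plane -/

section ProjectivePlane

variable {F : Type*} [Field F]

open Classical in
/-- The point `[b : c : e]` of the projective plane over `F`, as an element of the line at infinity
`e = 0` (the projective line, written as `Option F`) or of the affine plane `F × F`. The value at
`(0, 0, 0)` is irrelevant. -/
noncomputable def planePoint (b c e : F) : Option F ⊕ F × F :=
  if e = 0 then .inl (if b = 0 then none else some (c / b)) else .inr (b / e, c / e)

theorem planePoint_eq_inr {b c e : F} {p : F × F} :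
    planePoint b c e = .inr p ↔ e ≠ 0 ∧ b = e * p.1 ∧ c = e * p.2 := by
  obtain ⟨p, q⟩ := p
  by_cases he : e = 0
  · simp [planePoint, he]
  · simp [planePoint, he, div_eq_iff, mul_comm]

theorem planePoint_eq_some {b c e s : F} :
    planePoint b c e = .inl (some s) ↔ e = 0 ∧ b ≠ 0 ∧ c = b * s := by
  by_cases he : e = 0 <;> by_cases hb : b = 0 <;> simp [planePoint, he, hb, div_eq_iff, mul_comm]

theorem planePoint_eq_none {b c e : F} :
    planePoint b c e = .inl none ↔ e = 0 ∧ b = 0 := by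
  by_cases he : e = 0 <;> by_cases hb : b = 0 <;> simp [planePoint, he, hb]

/-- Two nonzero vectors define the same point if and only if their cross product vanishes. -/
theorem planePoint_eq_planePoint_iff {b c e b' c' e' : F} (h : ¬(b = 0 ∧ c = 0 ∧ e = 0))
    (h' : ¬(b' = 0 ∧ c' = 0 ∧ e' = 0)) :
    planePoint b c e = planePoint b' c' e' ↔
      b * c' = b' * c ∧ e * b' = e' * b ∧ e * c' = e' * c := by
  by_cases he : e' = 0
  · by_cases hb : b' = 0
    · have hc : c' ≠ 0 := fun hc => h' ⟨hb, hc, he⟩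
      rw [planePoint_eq_none.2 ⟨he, hb⟩, planePoint_eq_none]
      subst he hb
      simp [hc, and_comm]
    · rw [planePoint_eq_some.2 ⟨he, hb, (mul_div_cancel₀ c' hb).symm⟩, planePoint_eq_some]
      subst he
      constructor
      · rintro ⟨rfl, h1, rfl⟩
        simp only [zero_mul, and_true]
        field_simp
      · rintro ⟨h1, h2, h3⟩
        have he : e = 0 := by simpa [hb] using h2
        refine ⟨he, ?_, ?_⟩
        · rintro rfl
          refine h ⟨rfl, ?_, he⟩
          simpa [hb, eq_comm] using h1
        · field_simp
          linear_combination -h1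
  · rw [show planePoint b' c' e' = .inr (b' / e', c' / e') from planePoint_eq_inr.2
      ⟨he, by field_simp, by field_simp⟩, planePoint_eq_inr]
    constructor
    · rintro ⟨h1, rfl, rfl⟩
      refine ⟨?_, ?_, ?_⟩ <;> field_simp
    · rintro ⟨h1, h2, h3⟩
      have hb : b = e * (b' / e') := by field_simp; linear_combination -h2
      have hc : c = e * (c' / e') := by field_simp; linear_combination -h3
      refine ⟨?_, hb, hc⟩
      rintro rfl
      exact h ⟨by simpa using hb, by simpa using hc, rfl⟩

end ProjectivePlane

/-! ### Quadratics `z ^ 2 + z = m` in characteristic two -/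

section ArtinSchreier

variable {F : Type*} [Field F]

theorem artinSchreier_eq_iff [CharP F 2] {z w : F} : z ^ 2 + z = w ^ 2 + w ↔ z = w ∨ z = w + 1 := by
  have h2 : (2 : F) = 0 := CharTwo.two_eq_zero
  constructor
  · intro h
    have : (z - w) * (z - (w + 1)) = 0 := by linear_combination h + (w ^ 2 - z * w - z + w) * h2
    rcases mul_eq_zero.1 this with h | h
    · exact .inl (sub_eq_zero.1 h)
    · exact .inr (sub_eq_zero.1 h)
  · rintro (rfl | rfl)
    · rfl
    · linear_combination (w + 1) * h2

variable (F) in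
/-- The additive map `z ↦ z ^ 2 + z` of a field of characteristic two. -/
def artinSchreier [CharP F 2] : F →+ F where
  toFun z := z ^ 2 + z
  map_zero' := by simp
  map_add' z w := by rw [CharTwo.add_sq]; ring

theorem card_artinSchreier_eq [CharP F 2] {m : F} (hm : ∃ z, z ^ 2 + z = m) :
    Nat.card {z : F // z ^ 2 + z = m} = 2 := by
  obtain ⟨w, rfl⟩ := hm
  have : {z : F | z ^ 2 + z = w ^ 2 + w} = {w, w + 1} := by
    ext z; simp [artinSchreier_eq_iff]
  rw [← Set.coe_ofPred, Nat.card_coe_set_eq, this, Set.ncard_pair (by simp)]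

theorem card_artinSchreier_ne_of_exists [CharP F 2] [Finite F] {m : F}
    (hm : ∃ z, z ^ 2 + z = m) :
    Nat.card {z : F // z ^ 2 + z ≠ m} = Nat.card F - 2 := by
  classical
  rw [← Nat.card_congr (Equiv.sumCompl fun z : F => z ^ 2 + z = m), Nat.card_sum,
    card_artinSchreier_eq hm, Nat.add_sub_cancel_left]

theorem card_artinSchreier_ne_of_not_exists {m : F} (hm : ¬∃ z, z ^ 2 + z = m) :
    Nat.card {z : F // z ^ 2 + z ≠ m} = Nat.card F :=
  Nat.card_congr (Equiv.subtypeUnivEquiv fun z hz => hm ⟨z, hz⟩)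

/-- The Artin-Schreier map has kernel `{0, 1}`, so its image is half of the field. -/
theorem two_mul_card_exists_artinSchreier_eq [CharP F 2] :
    2 * Nat.card {m : F // ∃ z, z ^ 2 + z = m} = Nat.card F := by
  have h1 : Nat.card (artinSchreier F).ker = 2 :=
    card_artinSchreier_eq (F := F) ⟨0, by simp⟩
  have h2 : (artinSchreier F).ker.index = Nat.card {m : F // ∃ z, z ^ 2 + z = m} :=
    AddSubgroup.index_ker _
  rw [← h2, ← AddSubgroup.card_mul_index (artinSchreier F).ker, h1]

variable (F) in
/-- The affine points `(b, c)` for which `z ^ 2 + z + b * c` splits over `F`, a field of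
characteristic two. -/
abbrev SplitPoint : Type _ := {p : F × F // ∃ z, z ^ 2 + z = p.1 * p.2}

variable (F) in
/-- The affine points `(b, c)` for which `z ^ 2 + z + b * c` is irreducible over `F`, a
field of characteristic two. -/
abbrev NonsplitPoint : Type _ := {p : F × F // ¬∃ z, z ^ 2 + z = p.1 * p.2}

/-- Over `b = 0` every `c` is split; over `b ≠ 0` half of them are. -/
theorem two_mul_card_splitPoint [CharP F 2] [Finite F] :
    2 * Nat.card (SplitPoint F) = Nat.card F * (Nat.card F + 1) := by
  classical
  have := Fintype.ofFinite F
  have e : SplitPoint F ≃ Σ b : F, {c : F // ∃ z, z ^ 2 + z = b * c} :=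
    { toFun p := ⟨p.1.1, p.1.2, p.2⟩
      invFun s := ⟨(s.1, s.2.1), s.2.2⟩
      left_inv _ := rfl
      right_inv _ := rfl }
  have h0 : Nat.card {c : F // ∃ z, z ^ 2 + z = 0 * c} = Nat.card F :=
    Nat.card_congr (Equiv.subtypeUnivEquiv fun c => ⟨0, by simp⟩)
  have h1 : ∀ b ∈ Finset.univ.erase (0 : F), Nat.card {c : F // ∃ z, z ^ 2 + z = b * c} =
      Nat.card {m : F // ∃ z, z ^ 2 + z = m} := fun b hb =>
    Nat.card_congr ((Equiv.mulLeft₀ b (Finset.ne_of_mem_erase hb)).subtypeEquiv fun c => Iff.rfl)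
  have hq : 0 < Nat.card F := Nat.card_pos
  rw [Nat.card_congr e, Nat.card_sigma, ← Finset.add_sum_erase _ _ (Finset.mem_univ 0), h0,
    Finset.sum_congr rfl h1, Finset.sum_const, smul_eq_mul, Finset.card_erase_of_mem
    (Finset.mem_univ _), Finset.card_univ, ← Nat.card_eq_fintype_card, mul_add, mul_left_comm,
    two_mul_card_exists_artinSchreier_eq]
  obtain ⟨n, hn⟩ := Nat.exists_eq_add_of_lt hq
  rw [hn]
  simp only [zero_add, Nat.add_sub_cancel]
  ring

theorem card_splitPoint_add_card_nonsplitPoint [Finite F] :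
    Nat.card (SplitPoint F) + Nat.card (NonsplitPoint F) = Nat.card F * Nat.card F := by
  classical
  rw [← Nat.card_sum, Nat.card_congr (Equiv.sumCompl _), Nat.card_prod]

end ArtinSchreier

/-! ### Commuting matrices of determinant one in characteristic two -/

/-- An isomorphism of groups induces an isomorphism of commuting graphs. -/
def MulEquiv.commutingGraphIso {G H : Type*} [Group G] [Group H] (e : G ≃* H) :
    commutingGraph G ≃g commutingGraph H where
  toEquiv := e.toEquiv.subtypeEquiv fun g => by
    simp only [Subgroup.mem_center_iff, not_iff_not]
    refine e.toEquiv.forall_congr fun h => ?_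
    simp [← map_mul]
  map_rel_iff' {g h} := by
    simp [commutingGraph, ← map_mul, Subtype.ext_iff]

section SpecialLinear

open Matrix

variable {F : Type*} [Field F]

/-- Two matrices commute if and only if the vectors `(M₀₁, M₁₀, M₀₀ - M₁₁)` attached to them are
parallel. -/
theorem Matrix.SpecialLinearGroup.mul_comm_iff_fin_two {M N : SL(2, F)} :
    M * N = N * M ↔ M 0 1 * N 1 0 = N 0 1 * M 1 0 ∧
      (M 0 0 - M 1 1) * N 0 1 = (N 0 0 - N 1 1) * M 0 1 ∧
      (M 0 0 - M 1 1) * N 1 0 = (N 0 0 - N 1 1) * M 1 0 := by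
  simp only [Matrix.SpecialLinearGroup.ext_iff, Fin.forall_fin_two,
    Matrix.SpecialLinearGroup.coe_mul, Matrix.mul_apply, Fin.sum_univ_two]
  constructor
  · rintro ⟨⟨h1, h2⟩, h3, h4⟩
    refine ⟨?_, ?_, ?_⟩
    · linear_combination h1
    · linear_combination h2
    · linear_combination -h3
  · rintro ⟨h1, h2, h3⟩
    refine ⟨⟨?_, ?_⟩, ?_, ?_⟩
    · linear_combination h1
    · linear_combination h2
    · linear_combination -h3
    · linear_combination -h1

theorem Matrix.SpecialLinearGroup.det_fin_two_eq_one (M : SL(2, F)) :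
    M 0 0 * M 1 1 - M 0 1 * M 1 0 = 1 := by
  rw [← Matrix.det_fin_two, Matrix.SpecialLinearGroup.det_coe]

/-- The point of the projective plane attached to a matrix: it determines the span of `1` and the
matrix, when the matrix is not scalar. -/
noncomputable def matrixPoint (M : SL(2, F)) : Option F ⊕ F × F :=
  planePoint (M 0 1) (M 1 0) (M 0 0 - M 1 1)

variable [CharP F 2]

theorem Matrix.SpecialLinearGroup.eq_one_iff_fin_two {M : SL(2, F)} :
    M = 1 ↔ M 0 1 = 0 ∧ M 1 0 = 0 ∧ M 0 0 - M 1 1 = 0 := by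
  constructor
  · rintro rfl
    simp
  · rintro ⟨h1, h2, h3⟩
    have h := M.det_fin_two_eq_one
    rw [h1, zero_mul, sub_zero, ← sub_eq_zero.1 h3, ← sq] at h
    have h0 : M 0 0 = 1 := CharTwo.sq_inj.1 (h.trans (one_pow 2).symm)
    ext i j
    fin_cases i <;> fin_cases j <;> simp [h0, h1, h2, ← sub_eq_zero.1 h3]

theorem Matrix.SpecialLinearGroup.center_eq_bot_fin_two :
    Subgroup.center SL(2, F) = ⊥ := by
  refine (Subgroup.eq_bot_iff_forall _).2 fun M hM => ?_
  obtain ⟨r, -, hr⟩ := Matrix.SpecialLinearGroup.mem_center_iff.1 hM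
  simp [Matrix.SpecialLinearGroup.eq_one_iff_fin_two, ← hr]

theorem Matrix.SpecialLinearGroup.not_mem_center_iff_fin_two {M : SL(2, F)} :
    M ∉ Subgroup.center SL(2, F) ↔ ¬(M 0 1 = 0 ∧ M 1 0 = 0 ∧ M 0 0 - M 1 1 = 0) := by
  rw [Matrix.SpecialLinearGroup.center_eq_bot_fin_two, Subgroup.mem_bot,
    Matrix.SpecialLinearGroup.eq_one_iff_fin_two]

/-- Commuting is an equivalence relation on the noncentral matrices, whose classes are the fibres of
`matrixPoint`. -/
theorem commutingGraph_adj_iff_matrixPoint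
    (M N : {M : SL(2, F) // M ∉ Subgroup.center SL(2, F)}) :
    (commutingGraph SL(2, F)).Adj M N ↔ M ≠ N ∧ matrixPoint M.1 = matrixPoint N.1 := by
  rw [matrixPoint, matrixPoint, planePoint_eq_planePoint_iff
    (SpecialLinearGroup.not_mem_center_iff_fin_two.1 M.2)
    (SpecialLinearGroup.not_mem_center_iff_fin_two.1 N.2)]
  exact and_congr_right fun _ => SpecialLinearGroup.mul_comm_iff_fin_two

variable [Finite F]

theorem exists_sq_eq (a : F) : ∃ x, x ^ 2 = a :=
  (Finite.injective_iff_surjective.1 CharTwo.sq_injective) a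

/-- Over the line at infinity the matrices have both diagonal entries equal. Such a matrix is fixed
by a nonzero off-diagonal entry, since the determinant condition then prescribes the square of the
diagonal entry and squaring is bijective. -/
theorem card_matrixPoint_eq_inl (o : Option F) :
    Nat.card {M : {M : SL(2, F) // M ∉ Subgroup.center SL(2, F)} //
      matrixPoint M.1 = .inl o} = Nat.card F - 1 := by
  classical
  have h1 : Nat.card {x : F // x ≠ 0} = Nat.card F - 1 := by
    have := Fintype.ofFinite F
    rw [Nat.card_eq_fintype_card, Nat.card_eq_fintype_card, Fintype.card_subtype_compl,
      Fintype.card_subtype_eq]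
  rw [← h1]
  cases o with
  | none =>
    have hM (M : SL(2, F)) (hM : matrixPoint M = .inl none) : M 0 0 = 1 ∧ M 1 1 = 1 := by
      obtain ⟨he, hb⟩ := planePoint_eq_none.1 hM
      have hd := M.det_fin_two_eq_one
      rw [hb, zero_mul, sub_zero, ← sub_eq_zero.1 he, ← sq] at hd
      have h0 : M 0 0 = 1 := CharTwo.sq_inj.1 (hd.trans (one_pow 2).symm)
      exact ⟨h0, (sub_eq_zero.1 he).symm.trans h0⟩
    refine Nat.card_eq_of_bijective (fun M => ⟨M.1.1 1 0, fun hc => ?_⟩) ⟨?_, ?_⟩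
    · obtain ⟨⟨M, h⟩, hp⟩ := M
      obtain ⟨he, hb⟩ := planePoint_eq_none.1 hp
      exact SpecialLinearGroup.not_mem_center_iff_fin_two.1 h ⟨hb, hc, he⟩
    · rintro ⟨⟨M, h⟩, hp⟩ ⟨⟨N, h'⟩, hp'⟩ heq
      obtain ⟨he, hb⟩ := planePoint_eq_none.1 hp
      obtain ⟨he', hb'⟩ := planePoint_eq_none.1 hp'
      have hc : M 1 0 = N 1 0 := congrArg Subtype.val heq
      have h01 : M 0 1 = N 0 1 := hb.trans hb'.symm
      have : M = N := by
        ext i j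
        fin_cases i <;> fin_cases j <;>
          simp [h01, hc, (hM M hp).1, (hM M hp).2, (hM N hp').1, (hM N hp').2]
      subst this
      rfl
    · rintro ⟨x, hx⟩
      refine ⟨⟨⟨⟨!![1, 0; x, 1], by simp [Matrix.det_fin_two]⟩, ?_⟩, ?_⟩, ?_⟩
      · refine SpecialLinearGroup.not_mem_center_iff_fin_two.2 ?_
        simp [hx]
      · exact planePoint_eq_none.2 (by simp)
      · simp
  | some s =>
    have hM (M : SL(2, F)) (hM : matrixPoint M = .inl (some s)) :
        M 1 0 = M 0 1 * s ∧ M 1 1 = M 0 0 ∧ M 0 0 ^ 2 = 1 + M 0 1 ^ 2 * s := by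
      obtain ⟨he, hb, hc⟩ := planePoint_eq_some.1 hM
      have hd := M.det_fin_two_eq_one
      rw [← sub_eq_zero.1 he, hc] at hd
      exact ⟨hc, (sub_eq_zero.1 he).symm, by linear_combination hd⟩
    refine Nat.card_eq_of_bijective
      (fun M => ⟨M.1.1 0 1, (planePoint_eq_some.1 M.2).2.1⟩) ⟨?_, ?_⟩
    · rintro ⟨⟨M, h⟩, hp⟩ ⟨⟨N, h'⟩, hp'⟩ heq
      have hb : M 0 1 = N 0 1 := congrArg Subtype.val heq
      obtain ⟨hc, hd, ha⟩ := hM M hp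
      obtain ⟨hc', hd', ha'⟩ := hM N hp'
      rw [hb, ← ha', CharTwo.sq_inj] at ha
      have : M = N := by
        ext i j
        fin_cases i <;> fin_cases j <;> simp [ha, hb, hc, hd, hc', hd']
      subst this
      rfl
    · rintro ⟨x, hx⟩
      obtain ⟨a, ha⟩ := exists_sq_eq (1 + x ^ 2 * s)
      refine ⟨⟨⟨⟨!![a, x; x * s, a], ?_⟩, ?_⟩, ?_⟩, ?_⟩
      · rw [Matrix.det_fin_two_of]
        linear_combination ha
      · refine SpecialLinearGroup.not_mem_center_iff_fin_two.2 ?_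
        simp [hx]
      · exact planePoint_eq_some.2 (by simp [hx])
      · simp

/-- The matrices over an affine point `(b, c)` are, up to a scalar fixed by the determinant, the
matrices `z + (1, b; c, 0)`, whose determinant `z ^ 2 + z - b * c` has to be nonzero. -/
theorem card_matrixPoint_eq_inr (p : F × F) :
    Nat.card {M : {M : SL(2, F) // M ∉ Subgroup.center SL(2, F)} //
      matrixPoint M.1 = .inr p} = Nat.card {z : F // z ^ 2 + z ≠ p.1 * p.2} := by
  -- the determinant condition in the coordinates `e` and `z`
  have hM (M : SL(2, F)) (hM : matrixPoint M = .inr p) : ∃ e ≠ 0, ∃ z, M 1 1 / (M 0 0 - M 1 1) = z ∧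
      M 0 0 = e * (z + 1) ∧ M 0 1 = e * p.1 ∧ M 1 0 = e * p.2 ∧ M 1 1 = e * z ∧
      e ^ 2 * (z ^ 2 + z - p.1 * p.2) = 1 := by
    obtain ⟨he, hb, hc⟩ := planePoint_eq_inr.1 hM
    have h11 : M 1 1 = (M 0 0 - M 1 1) * (M 1 1 / (M 0 0 - M 1 1)) := by field_simp
    have h00 : M 0 0 = (M 0 0 - M 1 1) * (M 1 1 / (M 0 0 - M 1 1) + 1) := by
      field_simp; ring
    have hd := M.det_fin_two_eq_one
    refine ⟨_, he, _, rfl, h00, hb, hc, h11, ?_⟩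
    generalize M 1 1 / (M 0 0 - M 1 1) = z at *
    generalize M 0 0 - M 1 1 = e at *
    rw [h00, h11, hb, hc] at hd
    linear_combination hd
  refine Nat.card_eq_of_bijective
    (fun M => ⟨M.1.1 1 1 / (M.1.1 0 0 - M.1.1 1 1), fun hz => ?_⟩) ⟨?_, ?_⟩
  · obtain ⟨e, he, z, rfl, -, -, -, -, h⟩ := hM M.1.1 M.2
    rw [hz, sub_self, mul_zero] at h
    exact zero_ne_one h
  · rintro ⟨⟨M, h⟩, hp⟩ ⟨⟨N, h'⟩, hp'⟩ heq
    obtain ⟨e, he, z, hz, h00, h01, h10, h11, hd⟩ := hM M hp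
    obtain ⟨e', he', z', hz', h00', h01', h10', h11', hd'⟩ := hM N hp'
    have hzz : z = z' := hz.symm.trans ((congrArg Subtype.val heq).trans hz')
    subst hzz
    have hee : e = e' := by
      have h0 : z ^ 2 + z - p.1 * p.2 ≠ 0 := right_ne_zero_of_mul (hd.trans_ne one_ne_zero)
      exact CharTwo.sq_inj.1 (mul_right_cancel₀ h0 (hd.trans hd'.symm))
    subst hee
    have : M = N := by
      ext i j
      fin_cases i <;> fin_cases j <;> simp [h00, h01, h10, h11, h00', h01', h10', h11']
    subst this
    rfl
  · rintro ⟨z, hz⟩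
    obtain ⟨e, he⟩ := exists_sq_eq (z ^ 2 + z - p.1 * p.2)⁻¹
    have h0 : z ^ 2 + z - p.1 * p.2 ≠ 0 := sub_ne_zero.2 hz
    have hd : e ^ 2 * (z ^ 2 + z - p.1 * p.2) = 1 := by rw [he, inv_mul_cancel₀ h0]
    have he0 : e ≠ 0 := by rintro rfl; simp at hd
    have hdiff : e * (z + 1) - e * z = e := by ring
    refine ⟨⟨⟨⟨!![e * (z + 1), e * p.1; e * p.2, e * z], ?_⟩, ?_⟩, ?_⟩, ?_⟩
    · rw [Matrix.det_fin_two_of]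
      linear_combination hd
    · refine SpecialLinearGroup.not_mem_center_iff_fin_two.2 ?_
      simp [hdiff, he0]
    · exact planePoint_eq_inr.2 (by simp [hdiff, he0])
    · simp [hdiff, he0]

/-- The three kinds of fibres of `matrixPoint` are those over the line at infinity, over the split
and over the nonsplit affine points. -/
theorem nonempty_commutingGraph_SL_iso :
    Nonempty (commutingGraph SL(2, F) ≃g
      (copiesOfComplete (Nat.card F + 1) (Nat.card F - 1)
        ⊕g copiesOfComplete (Nat.card (SplitPoint F)) (Nat.card F - 2)
        ⊕g copiesOfComplete (Nat.card (NonsplitPoint F)) (Nat.card F))) := by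
  classical
  let σ : Option F ⊕ F × F ≃ (Option F ⊕ SplitPoint F) ⊕ NonsplitPoint F :=
    ((Equiv.refl _).sumCongr (Equiv.sumCompl _).symm).trans (Equiv.sumAssoc _ _ _).symm
  rw [← Finite.card_option]
  refine SimpleGraph.nonempty_iso_copiesOfComplete _ (fun M => σ (matrixPoint M.1)) ?_ ?_ ?_ ?_
  · intro M N
    rw [σ.injective.eq_iff, commutingGraph_adj_iff_matrixPoint]
  all_goals
    intro i
    simp only [← Equiv.eq_symm_apply]
  · exact card_matrixPoint_eq_inl i
  · exact (card_matrixPoint_eq_inr i.1).trans (card_artinSchreier_ne_of_exists i.2)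
  · exact (card_matrixPoint_eq_inr i.1).trans (card_artinSchreier_ne_of_not_exists i.2)

end SpecialLinear

theorem charP_two_of_card_eq_two_pow {F : Type*} [Field F] [Finite F] {k : ℕ} (hk : k ≠ 0)
    (hF : Nat.card F = 2 ^ k) : CharP F 2 := by
  refine CharTwo.of_one_ne_zero_of_two_eq_zero one_ne_zero ?_
  have := Fintype.ofFinite F
  have : (Nat.card F : F) = 0 := by rw [Nat.card_eq_fintype_card, FiniteField.cast_card_eq_zero]
  rw [hF] at this
  push_cast at this
  exact (pow_eq_zero_iff hk).1 this

/-! ### The commuting graph of the projective special linear group -/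

theorem add_one_add_sub_one_two_pow (k : ℕ) : 2 ^ k + 1 + (2 ^ k - 1) = 2 * 2 ^ k := by
  have := Nat.one_le_two_pow (n := k)
  omega

theorem nonempty_commutingGraph_PSL_iso {k : ℕ} (hk : k ≠ 0) {F : Type*} [Field F] [Finite F]
    (hF : Nat.card F = 2 ^ k) :
    Nonempty (commutingGraph PSL(2, F) ≃g
      (copiesOfComplete (2 ^ k + 1) (2 ^ k - 1)
        ⊕g copiesOfComplete (2 ^ (k - 1) * (2 ^ k + 1)) (2 ^ k - 2)
        ⊕g copiesOfComplete (2 ^ (k - 1) * (2 ^ k - 1)) (2 ^ k))) := by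
  have := charP_two_of_card_eq_two_pow hk hF
  have e : PSL(2, F) ≃* SL(2, F) :=
    (QuotientGroup.quotientMulEquivOfEq Matrix.SpecialLinearGroup.center_eq_bot_fin_two).trans
      QuotientGroup.quotientBot
  obtain ⟨φ⟩ := nonempty_commutingGraph_SL_iso (F := F)
  have hpow : 2 ^ k = 2 * 2 ^ (k - 1) := (mul_pow_sub_one hk 2).symm
  have hS := two_mul_card_splitPoint (F := F)
  have hT := card_splitPoint_add_card_nonsplitPoint (F := F)
  rw [hF] at hS hT
  have hS' : Nat.card (SplitPoint F) = 2 ^ (k - 1) * (2 ^ k + 1) := by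
    rw [hpow] at hS ⊢
    rw [mul_assoc] at hS
    exact Nat.eq_of_mul_eq_mul_left two_pos hS
  have hT' : Nat.card (NonsplitPoint F) = 2 ^ (k - 1) * (2 ^ k - 1) := by
    rw [hS'] at hT
    apply Nat.add_left_cancel (hT.trans _)
    rw [← mul_add, add_one_add_sub_one_two_pow, ← mul_assoc, mul_comm _ 2, ← hpow]
  rw [hF, hS', hT'] at φ
  exact ⟨e.commutingGraphIso.trans φ⟩

/-- The spectrum of `D + c A`. Each component `K_m` contributes `(m - 1) * (1 + c)` once and
`m - 1 - c` with multiplicity `m - 1`. -/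
theorem degAddAdjSpectrum_commutingGraph_PSL {k : ℕ} (hk : 2 ≤ k) {F : Type*} [Field F] [Finite F]
    (hF : Nat.card F = 2 ^ k) (c : ℝ) :
    SimpleGraph.degAddAdjSpectrum c (commutingGraph PSL(2, F)) =
      Multiset.replicate (2 ^ k + 1) (((2 : ℝ) ^ k - 2) * (1 + c))
      + Multiset.replicate (2 ^ (2 * k) - 2 ^ k - 2) ((2 : ℝ) ^ k - 2 - c)
      + Multiset.replicate (2 ^ (k - 1) * (2 ^ k + 1)) (((2 : ℝ) ^ k - 3) * (1 + c))
      + Multiset.replicate (2 ^ (k - 1) * (2 ^ (2 * k) - 2 ^ (k + 1) - 3)) ((2 : ℝ) ^ k - 3 - c)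
      + Multiset.replicate (2 ^ (k - 1) * (2 ^ k - 1)) (((2 : ℝ) ^ k - 1) * (1 + c))
      + Multiset.replicate (2 ^ (k - 1) * (2 ^ (2 * k) - 2 ^ (k + 1) + 1))
          ((2 : ℝ) ^ k - 1 - c) := by
  obtain ⟨φ⟩ := nonempty_commutingGraph_PSL_iso (by omega) hF
  rw [φ.degAddAdjSpectrum_eq, SimpleGraph.degAddAdjSpectrum_sum,
    SimpleGraph.degAddAdjSpectrum_sum]
  -- writing `2 ^ k = n + 4` turns the truncated differences into polynomials in `n`
  obtain ⟨n, hn⟩ : ∃ n, 2 ^ k = n + 4 :=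
    Nat.exists_eq_add_of_le' (Nat.pow_le_pow_right two_pos hk : 2 ^ 2 ≤ 2 ^ k)
  have hnR : (2 : ℝ) ^ k = n + 4 := by exact_mod_cast hn
  have hA : 2 ^ (2 * k) - 2 ^ k - 2 = (n + 5) * (n + 2) := by
    rw [mul_comm 2 k, pow_mul, hn, Nat.sub_sub]
    exact Nat.sub_eq_of_eq_add (by ring)
  have hB : 2 ^ (2 * k) - 2 ^ (k + 1) - 3 = (n + 5) * (n + 1) := by
    rw [mul_comm 2 k, pow_mul, pow_succ 2 k, hn, Nat.sub_sub]
    exact Nat.sub_eq_of_eq_add (by ring)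
  have hC : 2 ^ (2 * k) - 2 ^ (k + 1) + 1 = (n + 3) * (n + 3) := by
    have h : 2 ^ (2 * k) - 2 ^ (k + 1) = n ^ 2 + 6 * n + 8 := by
      rw [mul_comm 2 k, pow_mul, pow_succ 2 k, hn]
      exact Nat.sub_eq_of_eq_add (by ring)
    rw [h]
    ring
  rw [hA, hB, hC, hn, hnR, show n + 4 - 1 = n + 2 + 1 by omega, show n + 4 - 2 = n + 1 + 1 by omega,
    SimpleGraph.degAddAdjSpectrum_copiesOfComplete,
    SimpleGraph.degAddAdjSpectrum_copiesOfComplete,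
    show copiesOfComplete (2 ^ (k - 1) * (n + 2 + 1)) (n + 4) =
      copiesOfComplete (2 ^ (k - 1) * (n + 2 + 1)) (n + 3 + 1) from rfl,
    SimpleGraph.degAddAdjSpectrum_copiesOfComplete]
  simp only [← add_assoc, mul_assoc]
  push_cast
  have hrep {a b : ℕ} {x y : ℝ} (h : a = b) (h' : x = y) :
      Multiset.replicate a x = Multiset.replicate b y := by rw [h, h']
  refine congrArg₂ _ (congrArg₂ _ (congrArg₂ _ (congrArg₂ _ (congrArg₂ _ ?_ ?_) ?_) ?_) ?_) ?_ <;>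
    refine hrep ?_ ?_ <;> ring

theorem mainTheorem11 (k : ℕ) (hk : 2 ≤ k) (F : Type*) [Field F] [Finite F]
    (hF : Nat.card F = 2 ^ k) :
    laplacianSpectrum (commutingGraph PSL(2, F)) =
        Multiset.replicate (2 ^ (2 * k) + 2 ^ k + 1) (0 : ℝ)
        + Multiset.replicate (2 ^ (2 * k) - 2 ^ k - 2) ((2 : ℝ) ^ k - 1)
        + Multiset.replicate (2 ^ (k - 1) * (2 ^ (2 * k) - 2 ^ (k + 1) - 3)) ((2 : ℝ) ^ k - 2)
        + Multiset.replicate (2 ^ (k - 1) * (2 ^ (2 * k) - 2 ^ (k + 1) + 1)) ((2 : ℝ) ^ k)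
    ∧ signlessLaplacianSpectrum (commutingGraph PSL(2, F)) =
        Multiset.replicate (2 ^ k + 1) ((2 : ℝ) ^ (k + 1) - 4)
        + Multiset.replicate (2 ^ (2 * k) - 2 ^ k - 2) ((2 : ℝ) ^ k - 3)
        + Multiset.replicate (2 ^ (k - 1) * (2 ^ k + 1)) ((2 : ℝ) ^ (k + 1) - 6)
        + Multiset.replicate (2 ^ (k - 1) * (2 ^ (2 * k) - 2 ^ (k + 1) - 3)) ((2 : ℝ) ^ k - 4)
        + Multiset.replicate (2 ^ (k - 1) * (2 ^ k - 1)) ((2 : ℝ) ^ (k + 1) - 2)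
        + Multiset.replicate (2 ^ (k - 1) * (2 ^ (2 * k) - 2 ^ (k + 1) + 1)) ((2 : ℝ) ^ k - 2)
    ∧ IsLIntegral (commutingGraph PSL(2, F))
    ∧ IsQIntegral (commutingGraph PSL(2, F))
    ∧ Nonempty (commutingGraph PSL(2, F) ≃g
        (copiesOfComplete (2 ^ k + 1) (2 ^ k - 1)
          ⊕g copiesOfComplete (2 ^ (k - 1) * (2 ^ k + 1)) (2 ^ k - 2)
          ⊕g copiesOfComplete (2 ^ (k - 1) * (2 ^ k - 1)) (2 ^ k))) := by
  have hspec := degAddAdjSpectrum_commutingGraph_PSL hk hF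
  have h_int (c : ℤ) (x : ℝ)
      (hx : x ∈ SimpleGraph.degAddAdjSpectrum c (commutingGraph PSL(2, F))) : ∃ n : ℤ, x = n := by
    rw [hspec] at hx
    simp only [Multiset.mem_add, Multiset.mem_replicate] at hx
    rcases hx with ((((⟨-, rfl⟩ | ⟨-, rfl⟩) | ⟨-, rfl⟩) | ⟨-, rfl⟩) | ⟨-, rfl⟩) | ⟨-, rfl⟩
    · exact ⟨(2 ^ k - 2) * (1 + c), by push_cast; rfl⟩
    · exact ⟨2 ^ k - 2 - c, by push_cast; rfl⟩
    · exact ⟨(2 ^ k - 3) * (1 + c), by push_cast; rfl⟩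
    · exact ⟨2 ^ k - 3 - c, by push_cast; rfl⟩
    · exact ⟨(2 ^ k - 1) * (1 + c), by push_cast; rfl⟩
    · exact ⟨2 ^ k - 1 - c, by push_cast; rfl⟩
  refine ⟨?_, ?_, fun x hx => ?_, fun x hx => ?_, nonempty_commutingGraph_PSL_iso (by omega) hF⟩
  · -- the eigenvalue `0` occurs once for each component
    have h0 : 2 ^ (2 * k) + 2 ^ k + 1 =
        (2 ^ k + 1) + 2 ^ (k - 1) * (2 ^ k + 1) + 2 ^ (k - 1) * (2 ^ k - 1) := by
      rw [add_assoc (2 ^ k + 1), ← mul_add, add_one_add_sub_one_two_pow,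
        ← mul_assoc, mul_comm _ 2, mul_pow_sub_one (by omega), ← pow_add, ← two_mul]
      ring
    rw [SimpleGraph.laplacianSpectrum_eq, hspec, h0,
      Multiset.replicate_add (2 ^ k + 1 + 2 ^ (k - 1) * (2 ^ k + 1)),
      Multiset.replicate_add (2 ^ k + 1),
      show ((2 : ℝ) ^ k - 2) * (1 + -1) = 0 by ring, show ((2 : ℝ) ^ k - 3) * (1 + -1) = 0 by ring,
      show ((2 : ℝ) ^ k - 1) * (1 + -1) = 0 by ring, show (2 : ℝ) ^ k - 2 - -1 = 2 ^ k - 1 by ring,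
      show (2 : ℝ) ^ k - 3 - -1 = 2 ^ k - 2 by ring, show (2 : ℝ) ^ k - 1 - -1 = 2 ^ k by ring]
    abel
  · rw [SimpleGraph.signlessLaplacianSpectrum_eq, hspec,
      show ((2 : ℝ) ^ k - 2) * (1 + 1) = 2 ^ (k + 1) - 4 by ring,
      show ((2 : ℝ) ^ k - 3) * (1 + 1) = 2 ^ (k + 1) - 6 by ring,
      show ((2 : ℝ) ^ k - 1) * (1 + 1) = 2 ^ (k + 1) - 2 by ring,
      show (2 : ℝ) ^ k - 2 - 1 = 2 ^ k - 3 by ring, show (2 : ℝ) ^ k - 3 - 1 = 2 ^ k - 4 by ring,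
      show (2 : ℝ) ^ k - 1 - 1 = 2 ^ k - 2 by ring]
  · exact h_int (-1) x (by
      rwa [SimpleGraph.laplacianSpectrum_eq, ← Int.cast_one, ← Int.cast_neg] at hx)
  · exact h_int 1 x (by
      rwa [SimpleGraph.signlessLaplacianSpectrum_eq, ← Int.cast_one] at hx)
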